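/- Let $p$ be an odd prime, let $m,s$ be positive integers, and let $\mathbb F_{p^m}$ be a field with $p^m$ elements. For $\lambda\in\mathbb F_{p^m}\setminus\{0\}$, a $\lambda$-cyclic (constacyclic) code of length $N$ over $\mathbb F_{p^m}$ is a linear subspace of $\mathbb F_{p^m}^N$ closed under $(c_0,\dots,c_{N-1})\mapsto(\lambda c_{N-1},c_0,\dots,c_{N-2})$. Identify a word $(c_0,\dots,c_{N-1})$ with the class of $c_0+c_1x+\dots+c_{N-1}x^{N-1}$ in $\mathbb F_{p^m}[x]/\langle x^N-\lambda\rangle$. The Hamming distance $d_H(C)$ of a nonzero linear code $C$ is the minimum number of nonzero entries of a nonzero word of $C$. Let $\eta$ be a positive integer and let $\lambda,\xi,\psi\in\mathbb F_{p^m}\setminus\{0\}$ satisfy $\lambda=\psi^{p^s}$ and $x^{2\eta}-\psi=(x^\eta-\xi)(x^\eta+\xi)$, where both factors $x^\eta-\xi$ and $x^\eta+\xi$ are irreducible over $\mathbb F_{p^m}$. Then the $\lambda$-cyclic codes of length $2\eta p^s$ over $\mathbb F_{p^m}$ are exactly the ideals $$C_{i,j}=\langle (x^\eta-\xi)^i(x^\eta+\xi)^j\rangle\subset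 \mathbb F_{p^m}[x]/\langle x^{2\eta p^s}-\lambda\rangle,\qquad 0\le i,j\le p^s .$$ Moreover $C_{0,0}$ is the whole space $\mathbb F_{p^m}^{2\eta p^s}$ and $C_{p^s,p^s}=\{0\}$. For all other pairs $(i,j)$ with $0\le i,j\le p^s$, the Hamming distance is given by the following table. Write $B_\beta=\{t\in\mathbb Z:\beta p^{s-1}+1\le t\le(\beta+1)p^{s-1}\}$ and $T_{k,\tau}=\{t\in\mathbb Z:p^s-p^{s-k}+(\tau-1)p^{s-k-1}+1\le t\le p^s-p^{s-k}+\tau p^{s-k-1}\}$, where the parameters are integers with $1\le\beta'\le\beta\le p-2$, $1\le\tau,\tau_3,\tau_4\le p-1$, $1\le\tau_2<\tau_1\le p-1$, $1\le k\le s-1$ and $1\le k''<k'\le s-1$. 1. $0<i\le p^s$, $j=0$: $d_H=2$. 2. $0\le i\le p^{s-1}$, $0\le j\le p^{s-1}$: $d_H=2$. 3. $p^{s-1}<i\le 2p^{s-1}$, $0<j\le p^{s-1}$: $d_H=3$. 4. $2p^{s-1}<i\le p^s$, $0<j\le p^{s-1}$: $d_H=4$. 5. $i\in B_\beta$, $j\in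 B_{\beta'}$: $d_H=\min\{\beta+2,\,2(\beta'+2)\}$. 6. $i\in T_{k,\tau}$, $j\in B_\beta$: $d_H=2(\beta+2)$. 7. $i\in T_{k,\tau}$, $j\in T_{k,\tau}$: $d_H=(\tau+1)p^k$. 8. $i\in T_{k,\tau_1}$, $j\in T_{k,\tau_2}$: $d_H=\min\{2(\tau_2+1)p^k,\,(\tau_1+1)p^k\}$. 9. $i\in T_{k',\tau_3}$, $j\in T_{k'',\tau_4}$: $d_H=2(\tau_4+1)p^{k''}$. 10. $i=p^s$, $j\in B_\beta$: $d_H=2(\beta+2)$. 11. $i=p^s$, $j\in T_{k,\tau}$: $d_H=2(\tau+1)p^k$. Every row also holds with the roles of $i$ and $j$ interchanged, i.e. $d_H(C_{j,i})$ is equal to the same value, and the rows together with these symmetric versions cover all pairs $(i,j)$ with $0\le i,j\le p^s$ other than $(0,0)$ and $(p^s,p^s)$. Finally, unless $p\equiv 3\pmod 4$ and $m$ is odd, the above applies to the negacyclic codes of length $2p^s$: one has $-1=(-1)^{p^s}$, and there is $\xi\in\mathbb F_{p^m}\setminus\{0\}$ with $x^2+1=(x-\xi)(x+\xi)$ and both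 factors irreducible, so that the hypotheses hold with $\eta=1$ and $\lambda=\psi=-1$. -/

import Mathlib

open Polynomial

namespace RepeatedRoot

variable {F : Type*} [Field F]

/-- The `lam`-shift `(c₀, …, c_{N-1}) ↦ (lam * c_{N-1}, c₀, …, c_{N-2})` of a word of length `N`. -/
def constaShift {N : ℕ} (lam : F) (c : Fin N → F) : Fin N → F := fun i =>
  if (i : ℕ) = 0 then lam * c ⟨N - 1, Nat.sub_one_lt_of_lt i.isLt⟩
  else c ⟨(i : ℕ) - 1, lt_of_le_of_lt (Nat.sub_le _ _) i.isLt⟩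

/-- A linear code of length `N` over `F` is `lam`-cyclic (constacyclic) if it is closed under the
`lam`-shift. -/
def IsConstacyclic {N : ℕ} (lam : F) (D : Submodule F (Fin N → F)) : Prop :=
  ∀ c ∈ D, constaShift lam c ∈ D

/-- The ring `F[x] / ⟨x ^ N - lam⟩`. -/
abbrev Ambient (N : ℕ) (lam : F) : Type _ :=
  F[X] ⧸ Ideal.span {(X ^ N - C lam : F[X])}

/-- The identification of a word `(c₀, …, c_{N-1})` with the class of `c₀ + c₁ x + ⋯ +
c_{N-1} x ^ (N-1)` in `F[x] / ⟨x ^ N - lam⟩`. -/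
noncomputable def wordClass (N : ℕ) (lam : F) : (Fin N → F) →ₗ[F] Ambient N lam :=
  Fintype.linearCombination F fun i : Fin N =>
    Ideal.Quotient.mk (Ideal.span {(X ^ N - C lam : F[X])}) (X ^ (i : ℕ))

/-- An ideal of `F[x] / ⟨x ^ N - lam⟩` regarded as a linear code of length `N`. -/
noncomputable def codeOfIdeal {N : ℕ} {lam : F} (I : Ideal (Ambient N lam)) :
    Submodule F (Fin N → F) :=
  (I.restrictScalars F).comap (wordClass N lam)

/-- The code `⟨(x ^ η - ξ) ^ i * (x ^ η + ξ) ^ j⟩ ⊆ F[x] / ⟨x ^ N - lam⟩`. -/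
noncomputable def codeIJ (N : ℕ) (lam : F) (η : ℕ) (ξ : F) (i j : ℕ) :
    Submodule F (Fin N → F) :=
  codeOfIdeal (Ideal.span
    {Ideal.Quotient.mk (Ideal.span {(X ^ N - C lam : F[X])})
      ((X ^ η - C ξ) ^ i * (X ^ η + C ξ) ^ j)})

/-- `d` is the Hamming distance of the linear code `D`: the minimum of the Hamming weights
of the nonzero codewords (in particular, there is a nonzero codeword). -/
def HasHammingDistance [DecidableEq F] {N : ℕ} (D : Submodule F (Fin N → F)) (d : ℕ) : Prop :=
  IsLeast {w : ℕ | ∃ c ∈ D, c ≠ 0 ∧ hammingNorm c = w} d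

/-- `β p ^ (s-1) + 1 ≤ i ≤ (β + 1) p ^ (s-1)`. -/
def InBetaBlock (p s β i : ℕ) : Prop :=
  β * p ^ (s - 1) + 1 ≤ i ∧ i ≤ (β + 1) * p ^ (s - 1)

/-- `p ^ s - p ^ (s-k) + (τ-1) p ^ (s-k-1) + 1 ≤ i ≤ p ^ s - p ^ (s-k) + τ p ^ (s-k-1)`;
used only for `1 ≤ k ≤ s - 1` and `1 ≤ τ`, where no subtraction is truncated. -/
def InTauBlock (p s k τ i : ℕ) : Prop :=
  p ^ s - p ^ (s - k) + (τ - 1) * p ^ (s - k - 1) + 1 ≤ i ∧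
    i ≤ p ^ s - p ^ (s - k) + τ * p ^ (s - k - 1)

/-- The table of Hamming distances: `DistanceTable p s i j d` says that some row of the table
applies to the pair of exponents `(i, j)` and has the entry `d`. -/
inductive DistanceTable (p s : ℕ) : ℕ → ℕ → ℕ → Prop
  | right_zero (i : ℕ) (hi : 0 < i) (hi' : i ≤ p ^ s) : DistanceTable p s i 0 2
  | both_small (i j : ℕ) (hi : i ≤ p ^ (s - 1)) (hj : j ≤ p ^ (s - 1)) :
      DistanceTable p s i j 2
  | three (i j : ℕ) (hi : p ^ (s - 1) < i) (hi' : i ≤ 2 * p ^ (s - 1))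
      (hj : 0 < j) (hj' : j ≤ p ^ (s - 1)) : DistanceTable p s i j 3
  | four (i j : ℕ) (hi : 2 * p ^ (s - 1) < i) (hi' : i ≤ p ^ s)
      (hj : 0 < j) (hj' : j ≤ p ^ (s - 1)) : DistanceTable p s i j 4
  | beta_beta (i j β β' : ℕ) (hβ' : 1 ≤ β') (hβ : β' ≤ β) (hβp : β ≤ p - 2)
      (hi : InBetaBlock p s β i) (hj : InBetaBlock p s β' j) :
      DistanceTable p s i j (min (β + 2) (2 * (β' + 2)))
  | tau_beta (i j k τ β : ℕ) (hk : 1 ≤ k) (hk' : k ≤ s - 1) (hτ : 1 ≤ τ) (hτ' : τ ≤ p - 1)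
      (hβ : 1 ≤ β) (hβ' : β ≤ p - 2)
      (hi : InTauBlock p s k τ i) (hj : InBetaBlock p s β j) :
      DistanceTable p s i j (2 * (β + 2))
  | tau_eq (i j k τ : ℕ) (hk : 1 ≤ k) (hk' : k ≤ s - 1) (hτ : 1 ≤ τ) (hτ' : τ ≤ p - 1)
      (hi : InTauBlock p s k τ i) (hj : InTauBlock p s k τ j) :
      DistanceTable p s i j ((τ + 1) * p ^ k)
  | tau_lt (i j k τ₁ τ₂ : ℕ) (hk : 1 ≤ k) (hk' : k ≤ s - 1)
      (hτ₂ : 1 ≤ τ₂) (hτ : τ₂ < τ₁) (hτ₁ : τ₁ ≤ p - 1)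
      (hi : InTauBlock p s k τ₁ i) (hj : InTauBlock p s k τ₂ j) :
      DistanceTable p s i j (min (2 * (τ₂ + 1) * p ^ k) ((τ₁ + 1) * p ^ k))
  | level_lt (i j k' k'' τ₃ τ₄ : ℕ) (hk'' : 1 ≤ k'') (hk : k'' < k') (hk' : k' ≤ s - 1)
      (hτ₃ : 1 ≤ τ₃) (hτ₃' : τ₃ ≤ p - 1) (hτ₄ : 1 ≤ τ₄) (hτ₄' : τ₄ ≤ p - 1)
      (hi : InTauBlock p s k' τ₃ i) (hj : InTauBlock p s k'' τ₄ j) :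
      DistanceTable p s i j (2 * (τ₄ + 1) * p ^ k'')
  | full_beta (j β : ℕ) (hβ : 1 ≤ β) (hβ' : β ≤ p - 2) (hj : InBetaBlock p s β j) :
      DistanceTable p s (p ^ s) j (2 * (β + 2))
  | full_tau (j k τ : ℕ) (hk : 1 ≤ k) (hk' : k ≤ s - 1) (hτ : 1 ≤ τ) (hτ' : τ ≤ p - 1)
      (hj : InTauBlock p s k τ j) :
      DistanceTable p s (p ^ s) j (2 * (τ + 1) * p ^ k)

end RepeatedRoot

/-! Identify words with polynomials of degree less than `N`. The shift is multiplication by `X`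
modulo `X ^ N - lam`, so the codes are the ideals of the quotient ring, that is, the divisors of
`X ^ N - lam` up to units; the distance of the code of a divisor `G` is the least number of terms
of a nonzero multiple of `G` of degree less than `N`.

In characteristic `p`, a polynomial with a root `a ≠ 0` of multiplicity `e` has at least `∏ (d + 1)`
terms, where `d` runs through the base-`p` digits of `e` (Massey, Costello, Justesen). To see this,
sort the terms by their exponent modulo `p`; this strips one digit from `e`. Minimizing over the
multiplicities `e` with `i ≤ e < p ^ s` yields the distance for a single root.

Sorting the terms by the parity of their exponent reduces the roots `ξ` and `-ξ` to the single root
`ξ ^ 2`: if both parts are nonzero, each is a multiple of `(X - ξ ^ 2) ^ min i j`, and if one of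
them vanishes, the other is a multiple of `(X - ξ ^ 2) ^ max i j`. So the distance for `j ≤ i` is
`min d_i (2 * d_j)`, where `d_i` is the one-root distance, infinite for `i = p ^ s`. Finally,
sorting the exponents modulo `η` shows that substituting `X ^ η` for `X` does not change the
distance. -/

namespace RepeatedRoot

section Slice

variable {R : Type*} [CommSemiring R] {n r : ℕ}

/-- The polynomial formed by the coefficients of `f` at the exponents congruent to `r` modulo `n`,
so that `f = ∑ r < n, X ^ r * slice n r f (X ^ n)`. -/
noncomputable def slice (n r : ℕ) (f : R[X]) : R[X] :=
  ∑ k ∈ Finset.range (f.natDegree + 1), monomial k (f.coeff (n * k + r))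

theorem coeff_slice (hn : 0 < n) (r : ℕ) (f : R[X]) (k : ℕ) :
    (slice n r f).coeff k = f.coeff (n * k + r) := by
  simp only [slice, finsetSum_coeff, coeff_monomial, Finset.sum_ite_eq', Finset.mem_range]
  split_ifs with hk
  · rfl
  · rw [coeff_eq_zero_of_natDegree_lt]
    nlinarith

theorem coeff_X_pow_mul_expand {i : ℕ} (hi : i < n) (hr : r < n) (g : R[X]) (k : ℕ) :
    (X ^ i * expand R n g).coeff (n * k + r) = if i = r then g.coeff k else 0 := by
  have hn : 0 < n := by omega
  rw [coeff_X_pow_mul', coeff_expand hn]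
  split_ifs with hle hdvd hir hir hir
  · rw [hir, Nat.add_sub_cancel, Nat.mul_div_cancel_left _ hn]
  · refine absurd ?_ hir
    have hmod : i ≡ n * k + r [MOD n] := (Nat.modEq_iff_dvd' hle).2 hdvd
    simpa [Nat.ModEq, Nat.mod_eq_of_lt, hi, hr] using hmod
  · subst hir
    simp at hdvd
  · rfl
  · omega
  · rfl

theorem slice_sum_X_pow_mul_expand (hr : r < n) (g : ℕ → R[X]) :
    slice n r (∑ i ∈ Finset.range n, X ^ i * expand R n (g i)) = g r := by
  ext k
  rw [coeff_slice (by omega), finsetSum_coeff, Finset.sum_congr rfl fun i hi =>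
    coeff_X_pow_mul_expand (Finset.mem_range.1 hi) hr (g i) k]
  simp [hr]

theorem sum_X_pow_mul_expand_slice (hn : 0 < n) (f : R[X]) :
    ∑ r ∈ Finset.range n, X ^ r * expand R n (slice n r f) = f := by
  ext m
  rw [← Nat.div_add_mod m n, ← coeff_slice hn,
    slice_sum_X_pow_mul_expand (Nat.mod_lt m hn), coeff_slice hn]

theorem slice_expand_mul (hr : r < n) (q f : R[X]) :
    slice n r (expand R n q * f) = q * slice n r f := by
  conv_lhs => rw [← sum_X_pow_mul_expand_slice (by omega : 0 < n) f, Finset.mul_sum]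
  simp_rw [mul_left_comm (expand R n q), ← map_mul]
  exact slice_sum_X_pow_mul_expand hr fun i => q * slice n i f

theorem dvd_slice (hr : r < n) {q f : R[X]} (h : expand R n q ∣ f) : q ∣ slice n r f := by
  obtain ⟨g, rfl⟩ := h
  exact ⟨slice n r g, slice_expand_mul hr q g⟩

theorem eq_X_pow_mul_expand_slice (hr : r < n) {f : R[X]}
    (h : ∀ i < n, i ≠ r → slice n i f = 0) : f = X ^ r * expand R n (slice n r f) := by
  conv_lhs => rw [← sum_X_pow_mul_expand_slice (by omega : 0 < n) f]
  refine Finset.sum_eq_single_of_mem r (Finset.mem_range.2 hr) fun i hi hir => ?_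
  rw [h i (Finset.mem_range.1 hi) hir, map_zero, mul_zero]

theorem exists_slice_ne_zero (hn : 0 < n) {f : R[X]} (hf : f ≠ 0) :
    ∃ r < n, slice n r f ≠ 0 := by
  by_contra! h
  refine hf ?_
  rw [eq_X_pow_mul_expand_slice hn fun i hi _ => h i hi, h 0 hn, map_zero, mul_zero]

theorem degree_slice_lt (hn : 0 < n) (r : ℕ) {f : R[X]} {L : ℕ} (h : f.degree < (n * L : ℕ)) :
    (slice n r f).degree < L := by
  rw [degree_lt_iff_coeff_zero] at h ⊢
  intro m hm
  rw [coeff_slice hn]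
  exact h _ (by nlinarith)

theorem sum_card_support_slice (hn : 0 < n) (f : R[X]) :
    ∑ r ∈ Finset.range n, (slice n r f).support.card = f.support.card := by
  rw [Finset.card_eq_sum_card_fiberwise (f := fun k => k % n) (t := Finset.range n)
    (fun k _ => by simpa using Nat.mod_lt k hn)]
  refine Finset.sum_congr rfl fun r hr => ?_
  have hr := Finset.mem_range.1 hr
  refine Finset.card_bij' (fun k _ => n * k + r) (fun k _ => k / n) ?_ ?_ ?_ ?_
  · intro k hk
    simp only [Finset.mem_filter, mem_support_iff, coeff_slice hn] at hk ⊢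
    exact ⟨hk, by rw [Nat.mul_add_mod, Nat.mod_eq_of_lt hr]⟩
  · intro k hk
    simp only [Finset.mem_filter, mem_support_iff, coeff_slice hn] at hk ⊢
    rw [← hk.2, Nat.div_add_mod]
    exact hk.1
  · intro k _
    rw [Nat.mul_add_div hn, Nat.div_eq_of_lt hr, add_zero]
  · intro k hk
    rw [← (Finset.mem_filter.1 hk).2, Nat.div_add_mod]

theorem card_support_slice_le (hr : r < n) (f : R[X]) :
    (slice n r f).support.card ≤ f.support.card := by
  rw [← sum_card_support_slice (by omega : 0 < n) f]
  exact Finset.single_le_sum (f := fun r => (slice n r f).support.card) (fun _ _ => Nat.zero_le _)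
    (Finset.mem_range.2 hr)

theorem card_support_expand (hn : 0 < n) (g : R[X]) :
    (expand R n g).support.card = g.support.card := by
  have hsupp : (expand R n g).support = g.support.image (· * n) := by
    ext k
    simp only [mem_support_iff, coeff_expand hn, Finset.mem_image, ne_eq, ite_eq_right_iff,
      Classical.not_imp]
    constructor
    · rintro ⟨⟨l, rfl⟩, hl⟩
      exact ⟨l, by rwa [Nat.mul_div_cancel_left _ hn] at hl, mul_comm l n⟩
    · rintro ⟨l, hl, rfl⟩
      exact ⟨dvd_mul_left n l, by rwa [Nat.mul_div_cancel _ hn]⟩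
  rw [hsupp, Finset.card_image_of_injective _ (mul_left_injective₀ hn.ne')]

end Slice

section Remainder

variable {R : Type*} [CommRing R] [Nontrivial R]

theorem coeff_modByMonic_X_pow_sub_C {n r : ℕ} (hr : r < n) (f : R[X]) (b : R) :
    (f %ₘ (X ^ n - C b)).coeff r = (slice n r f).eval b := by
  have hn : 0 < n := by omega
  have hmonic : (X ^ n - C b).Monic := monic_X_pow_sub_C b hn.ne'
  set K : R[X] := ∑ i ∈ Finset.range n, X ^ i * expand R n (C ((slice n i f).eval b)) with hK
  have hdvd : X ^ n - C b ∣ f - K := by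
    conv_rhs => rw [← sum_X_pow_mul_expand_slice hn f, hK, ← Finset.sum_sub_distrib]
    refine Finset.dvd_sum fun i _ => ?_
    have hexp : X ^ n - C b = expand R n (X - C b) := by simp
    rw [hexp, ← mul_sub, ← map_sub]
    exact (_root_.map_dvd _ X_sub_C_dvd_sub_C_eval).mul_left _
  have hdeg : K.degree < (X ^ n - C b).degree := by
    rw [degree_X_pow_sub_C hn]
    refine (degree_sum_le _ _).trans_lt
      ((Finset.sup_lt_iff (WithBot.bot_lt_coe n)).2 fun i hi => ?_)
    rw [expand_C, mul_comm]
    exact (degree_C_mul_X_pow_le i _).trans_lt (Nat.cast_lt.2 (Finset.mem_range.1 hi))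
  rw [modByMonic_eq_of_dvd_sub hmonic hdvd, (modByMonic_eq_self_iff hmonic).2 hdeg]
  rw [← zero_add r, ← mul_zero n, ← coeff_slice hn, hK, slice_sum_X_pow_mul_expand hr,
    coeff_C_zero, mul_zero, zero_add]

end Remainder

section Support

variable {R : Type*} [Semiring R]

theorem card_support_X_mul (f : R[X]) : (X * f).support.card = f.support.card := by
  have hsupp : (X * f).support = f.support.image (· + 1) := by
    ext (_ | k) <;> simp
  rw [hsupp, Finset.card_image_of_injective _ (add_left_injective 1)]

theorem card_support_derivative_lt {f : R[X]} (h0 : f.coeff 0 ≠ 0) :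
    (derivative f).support.card < f.support.card := by
  rw [← Finset.card_erase_add_one (mem_support_iff.2 h0), Nat.lt_succ_iff]
  refine Finset.card_le_card_of_injOn (· + 1) (fun k hk => ?_) (add_left_injective 1).injOn
  simp only [Finset.mem_coe, mem_support_iff, coeff_derivative] at hk
  simpa using left_ne_zero_of_mul hk

end Support

section DigitWeight

theorem X_sub_C_pow_char_pow_mul {R : Type*} [CommRing R] (p : ℕ) [Fact p.Prime] [CharP R p]
    (a : R) (t e : ℕ) :
    (X - C a : R[X]) ^ (p ^ t * e) = expand R (p ^ t) ((X - C (a ^ p ^ t)) ^ e) := by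
  rw [pow_mul, sub_pow_char_pow, map_pow, map_sub, expand_X, expand_C, C_pow]

variable {R : Type*} [CommRing R] [IsDomain R]

theorem derivative_ne_zero_of_natDegree_lt_char {p : ℕ} [CharP R p] {f : R[X]}
    (hpos : 0 < f.natDegree) (hlt : f.natDegree < p) : derivative f ≠ 0 := by
  intro hder
  rw [← expand_contract p hder (by omega), natDegree_expand] at hpos hlt
  have := pos_of_mul_pos_left hpos (Nat.zero_le p)
  nlinarith

theorem lt_card_support_of_natDegree_lt_char {p : ℕ} [CharP R p] {a : R} (ha : a ≠ 0)
    {f : R[X]} (hf : f ≠ 0) (hdeg : f.natDegree < p) {e : ℕ} (h : (X - C a) ^ e ∣ f) :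
    e < f.support.card := by
  induction hN : f.natDegree using Nat.strong_induction_on generalizing f e with
  | _ N ih =>
    subst hN
    rcases Nat.eq_zero_or_pos e with rfl | he
    · exact Finset.card_pos.2 (nonempty_support_iff.2 hf)
    by_cases h0 : f.coeff 0 = 0
    · obtain ⟨g, rfl⟩ := X_dvd_iff.2 h0
      have hg : g ≠ 0 := right_ne_zero_of_mul hf
      rw [natDegree_X_mul hg] at ih hdeg
      have hX : ¬ X - C a ∣ X := by simpa [dvd_iff_isRoot] using ha
      rw [card_support_X_mul]
      exact ih _ (Nat.lt_succ_self _) hg (by omega)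
        ((prime_X_sub_C a).pow_dvd_of_dvd_mul_left e hX h) rfl
    · have hpos : 0 < f.natDegree := by
        have := natDegree_le_of_dvd h hf
        rw [natDegree_pow, natDegree_X_sub_C] at this
        omega
      have hlt := natDegree_derivative_lt hpos.ne'
      have := ih _ hlt (derivative_ne_zero_of_natDegree_lt_char hpos hdeg) (hlt.trans hdeg)
        (pow_sub_one_dvd_derivative_of_pow_dvd h) rfl
      have := card_support_derivative_lt h0
      omega

/-- The product of the numbers `d + 1`, where `d` runs through the base-`p` digits of `e`: in
characteristic `p` this is the number of terms of `(X - a) ^ e`, and the least number of terms of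
a polynomial with a root `a ≠ 0` of multiplicity `e`. -/
def digitWeight (p e : ℕ) : ℕ := ((Nat.digits p e).map (· + 1)).prod

@[simp]
theorem digitWeight_zero (p : ℕ) : digitWeight p 0 = 1 := by simp [digitWeight]

theorem digitWeight_eq {p : ℕ} (hp : 1 < p) (e : ℕ) :
    digitWeight p e = (e % p + 1) * digitWeight p (e / p) := by
  rcases Nat.eq_zero_or_pos e with rfl | he
  · simp
  · simp [digitWeight, Nat.digits_def' hp he]

theorem le_of_X_sub_C_pow_dvd_pow_mul {a : R} {n k : ℕ} {h : R[X]} (hh : h.eval a ≠ 0)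
    (hdvd : (X - C a) ^ n ∣ (X - C a) ^ k * h) : n ≤ k := by
  by_contra! hlt
  have hdvd' := (pow_dvd_pow (X - C a) hlt).trans hdvd
  rw [pow_succ, mul_dvd_mul_iff_left (pow_ne_zero _ (X_sub_C_ne_zero a)), dvd_iff_isRoot] at hdvd'
  exact hh hdvd'

theorem lt_card_support_modByMonic {p : ℕ} [Fact p.Prime] [CharP R p] {a : R} (ha : a ≠ 0)
    {r : ℕ} (hr : r < p) {h : R[X]} (hh : h.eval a ≠ 0) :
    r < (((X - C a) ^ r * h) %ₘ (X ^ p - C (a ^ p))).support.card := by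
  have hpow : X ^ p - C (a ^ p) = (X - C a) ^ p := by rw [sub_pow_char, C_pow]
  have hmonic : (X ^ p - C (a ^ p)).Monic := monic_X_pow_sub_C _ (by omega)
  refine lt_card_support_of_natDegree_lt_char (p := p) ha ?_ ?_ ?_
  · rw [Ne, modByMonic_eq_zero_iff_dvd hmonic, hpow]
    exact fun hdvd => hr.not_ge (le_of_X_sub_C_pow_dvd_pow_mul hh hdvd)
  · have hlt := natDegree_modByMonic_lt ((X - C a) ^ r * h) hmonic
    rw [natDegree_X_pow_sub_C] at hlt
    refine hlt fun h1 => ?_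
    have := congrArg natDegree h1
    rw [natDegree_X_pow_sub_C, natDegree_one] at this
    omega
  · rw [modByMonic_eq_sub_mul_div, hpow]
    exact dvd_sub (dvd_mul_right _ _) ((pow_dvd_pow _ hr.le).mul_right _)

/-- For `e = p * q + r` the slices modulo `p` are the slices of `(X - a) ^ r * h` times
`(X - a ^ p) ^ q`; at least `r + 1` of the former do not vanish at `a ^ p`. -/
theorem digitWeight_le_card_support_mul {p : ℕ} [hp : Fact p.Prime] [CharP R p] (e : ℕ) {a : R}
    (ha : a ≠ 0) {h : R[X]} (hh : h.eval a ≠ 0) :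
    digitWeight p e ≤ ((X - C a) ^ e * h).support.card := by
  induction e using Nat.strong_induction_on generalizing a h with
  | _ e ih =>
    rcases Nat.eq_zero_or_pos e with rfl | he
    · rw [digitWeight_zero, pow_zero, one_mul]
      exact Finset.card_pos.2 (nonempty_support_iff.2 (by rintro rfl; simp at hh))
    have hp0 : 0 < p := hp.out.pos
    have hmod : e % p < p := Nat.mod_lt e hp0
    set H : R[X] := (X - C a) ^ (e % p) * h
    set K : R[X] := H %ₘ (X ^ p - C (a ^ p))
    have hfactor : (X - C a) ^ e * h = expand R p ((X - C (a ^ p)) ^ (e / p)) * H := by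
      have hexp := X_sub_C_pow_char_pow_mul p a 1 (e / p)
      rw [pow_one] at hexp
      rw [← hexp, ← mul_assoc, ← pow_add, Nat.div_add_mod]
    have hslice : ∀ r ∈ K.support, r < p ∧
        digitWeight p (e / p) ≤ (slice p r ((X - C a) ^ e * h)).support.card := by
      intro r hr
      have hrp : r < p := by
        by_contra hle
        exact mem_support_iff.1 hr (coeff_eq_zero_of_degree_lt
          ((degree_modByMonic_lt _ (monic_X_pow_sub_C _ hp0.ne')).trans_le
            (by rw [degree_X_pow_sub_C hp0]; exact_mod_cast not_lt.1 hle)))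
      rw [mem_support_iff, coeff_modByMonic_X_pow_sub_C hrp] at hr
      rw [hfactor, slice_expand_mul hrp]
      exact ⟨hrp, ih _ (Nat.div_lt_self he hp.out.one_lt) (pow_ne_zero p ha) hr⟩
    calc digitWeight p e = (e % p + 1) * digitWeight p (e / p) :=
          digitWeight_eq hp.out.one_lt e
      _ ≤ K.support.card * digitWeight p (e / p) :=
          Nat.mul_le_mul_right _ (lt_card_support_modByMonic ha hmod hh)
      _ ≤ ∑ r ∈ K.support, (slice p r ((X - C a) ^ e * h)).support.card :=
          Finset.card_nsmul_le_sum _ _ _ fun r hr => (hslice r hr).2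
      _ ≤ ∑ r ∈ Finset.range p, (slice p r ((X - C a) ^ e * h)).support.card :=
          Finset.sum_le_sum_of_subset fun r hr => Finset.mem_range.2 (hslice r hr).1
      _ = _ := sum_card_support_slice hp0 _

theorem digitWeight_rootMultiplicity_le_card_support {p : ℕ} [Fact p.Prime] [CharP R p] {a : R}
    (ha : a ≠ 0) {f : R[X]} (hf : f ≠ 0) :
    digitWeight p (f.rootMultiplicity a) ≤ f.support.card := by
  have h := digitWeight_le_card_support_mul (p := p) (f.rootMultiplicity a) ha
    (eval_divByMonic_pow_rootMultiplicity_ne_zero a hf)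
  rwa [pow_mul_divByMonic_rootMultiplicity_eq] at h

end DigitWeight

section Digits

variable {p : ℕ}

theorem digitWeight_pos (e : ℕ) : 0 < digitWeight p e :=
  List.prod_pos (by simp)

theorem digitWeight_of_lt {c : ℕ} (hc : c < p) : digitWeight p c = c + 1 := by
  rcases Nat.eq_zero_or_pos c with rfl | hpos
  · simp
  · simp [digitWeight, Nat.digits_of_lt p c hpos.ne' hc]

theorem digitWeight_mul_add (hp : 1 < p) (a : ℕ) {t b : ℕ} (hb : b < p ^ t) :
    digitWeight p (p ^ t * a + b) = digitWeight p a * digitWeight p b := by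
  induction t generalizing b with
  | zero =>
    obtain rfl : b = 0 := by simpa using hb
    simp
  | succ t ih =>
    have hsplit : p ^ (t + 1) * a + b = b + p * (p ^ t * a) := by ring
    have hdiv : b / p < p ^ t := Nat.div_lt_of_lt_mul (by rwa [pow_succ'] at hb)
    rw [digitWeight_eq hp, hsplit, Nat.add_mul_mod_self_left, Nat.add_mul_div_left _ _ (by omega),
      add_comm, digitWeight_eq hp b, add_comm (b / p), ih hdiv]
    ring

theorem mul_pow_sub_one_add (hp : 0 < p) (k : ℕ) : p * (p ^ k - 1) + p = p ^ (k + 1) := by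
  rw [← Nat.mul_succ, Nat.succ_eq_add_one, Nat.sub_add_cancel (Nat.pow_pos hp), pow_succ']

theorem digitWeight_pow_sub_one (hp : 1 < p) (k : ℕ) : digitWeight p (p ^ k - 1) = p ^ k := by
  induction k with
  | zero => simp
  | succ k ih =>
    have hsplit : p ^ (k + 1) - 1 = p ^ 1 * (p ^ k - 1) + (p - 1) := by
      have := mul_pow_sub_one_add (by omega : 0 < p) k
      rw [pow_one]
      omega
    rw [hsplit, digitWeight_mul_add hp _ (by rw [pow_one]; omega), ih,
      digitWeight_of_lt (by omega), Nat.sub_add_cancel hp.le, pow_succ]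

theorem digitWeight_mul_pow_sub_one_add (hp : 1 < p) (k : ℕ) {c : ℕ} (hc : c < p) :
    digitWeight p (p * (p ^ k - 1) + c) = (c + 1) * p ^ k := by
  have hsplit := digitWeight_mul_add hp (p ^ k - 1) (t := 1) (by rwa [pow_one])
  rw [pow_one] at hsplit
  rw [hsplit, digitWeight_of_lt hc, digitWeight_pow_sub_one hp, mul_comm]

theorem two_le_digitWeight (hp : 1 < p) {e : ℕ} (he : 0 < e) : 2 ≤ digitWeight p e := by
  induction e using Nat.strong_induction_on with
  | _ e ih =>
    rw [digitWeight_eq hp]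
    rcases Nat.eq_zero_or_pos (e % p) with hmod | hmod
    · have hdiv : 0 < e / p := Nat.div_pos (Nat.le_of_dvd he (Nat.dvd_of_mod_eq_zero hmod))
        (by omega)
      rw [hmod, zero_add, one_mul]
      exact ih (e / p) (Nat.div_lt_self he hp) hdiv
    · exact Nat.mul_le_mul (Nat.succ_le_succ hmod) (digitWeight_pos (e / p))

/-- The exponent `e = p ^ t * (p * (p ^ k - 1) + c + x) + b` has `k` leading digits `p - 1`, then
the digit `c + x`, and either `x > 0` or there is a nonzero digit in `b`. -/
theorem le_digitWeight (hp : 1 < p) {t k c e : ℕ} (hlt : p ^ t * (p * (p ^ k - 1) + c) < e)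
    (hlt' : e < p ^ (t + k + 1)) : (c + 2) * p ^ k ≤ digitWeight p e := by
  have ht : 0 < p ^ t := by positivity
  have hdm := Nat.div_add_mod e (p ^ t)
  have hb : e % p ^ t < p ^ t := Nat.mod_lt _ ht
  obtain ⟨x, hx⟩ : ∃ x, e / p ^ t = p * (p ^ k - 1) + (c + x) := by
    have hle : p * (p ^ k - 1) + c ≤ e / p ^ t :=
      (Nat.le_div_iff_mul_le ht).2 (by rw [mul_comm]; exact hlt.le)
    exact ⟨e / p ^ t - (p * (p ^ k - 1) + c), by omega⟩
  have hdigit : c + x < p := by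
    have hdiv : e / p ^ t < p ^ (k + 1) :=
      Nat.div_lt_of_lt_mul (by rwa [← pow_add, ← add_assoc])
    have := mul_pow_sub_one_add (by omega : 0 < p) k
    omega
  have hweight : digitWeight p e = (c + x + 1) * p ^ k * digitWeight p (e % p ^ t) := by
    conv_lhs => rw [← hdm]
    rw [digitWeight_mul_add hp _ hb, hx, digitWeight_mul_pow_sub_one_add hp k hdigit]
  rw [hweight]
  rcases Nat.eq_zero_or_pos x with rfl | hxpos
  · have hbpos : 0 < e % p ^ t := by
      rw [hx, add_zero] at hdm
      omega
    calc (c + 2) * p ^ k ≤ (c + 0 + 1) * p ^ k * 2 := by nlinarith [Nat.zero_le (c * p ^ k)]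
      _ ≤ _ := Nat.mul_le_mul_left _ (two_le_digitWeight hp hbpos)
  · calc (c + 2) * p ^ k ≤ (c + x + 1) * p ^ k := Nat.mul_le_mul_right _ (by omega)
      _ ≤ _ := Nat.le_mul_of_pos_right _ (digitWeight_pos _)

end Digits

section MultipleWeights

variable {R : Type*} [CommSemiring R]

/-- The numbers of terms of the nonzero multiples of `G` of degree less than `L`: for `G` dividing
`X ^ L - lam`, the Hamming weights of the nonzero words of the code generated by `G`. -/
def multipleWeights (G : R[X]) (L : ℕ) : Set ℕ :=
  {w | ∃ f : R[X], f ≠ 0 ∧ G ∣ f ∧ f.degree < L ∧ f.support.card = w}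

theorem pos_of_mem_multipleWeights {G : R[X]} {L w : ℕ} (hw : w ∈ multipleWeights G L) :
    0 < w := by
  obtain ⟨f, hf, -, -, rfl⟩ := hw
  exact Finset.card_pos.2 (nonempty_support_iff.2 hf)

theorem multipleWeights_subset_of_dvd {G G' : R[X]} (h : G' ∣ G) (L : ℕ) :
    multipleWeights G L ⊆ multipleWeights G' L := by
  rintro w ⟨f, hf, hG, hdeg, hw⟩
  exact ⟨f, hf, h.trans hG, hdeg, hw⟩

theorem multipleWeights_subset_expand {n : ℕ} (hn : 0 < n) (G : R[X]) (L : ℕ) :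
    multipleWeights G L ⊆ multipleWeights (expand R n G) (n * L) := by
  rintro w ⟨f, hf, hG, hdeg, rfl⟩
  refine ⟨expand R n f, (expand_ne_zero hn).2 hf, _root_.map_dvd _ hG, ?_,
    card_support_expand hn f⟩
  rw [← natDegree_lt_iff_degree_lt hf] at hdeg
  rw [← natDegree_lt_iff_degree_lt ((expand_ne_zero hn).2 hf), natDegree_expand, mul_comm]
  exact Nat.mul_lt_mul_of_pos_left hdeg hn

theorem isLeast_multipleWeights_expand {n : ℕ} (hn : 0 < n) {G : R[X]} {L d : ℕ}
    (h : IsLeast (multipleWeights G L) d) :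
    IsLeast (multipleWeights (expand R n G) (n * L)) d := by
  refine ⟨multipleWeights_subset_expand hn G L h.1, ?_⟩
  rintro w ⟨f, hf, hdvd, hdeg, rfl⟩
  obtain ⟨r, hr, hne⟩ := exists_slice_ne_zero hn hf
  exact (h.2 ⟨_, hne, dvd_slice hr hdvd, degree_slice_lt hn r hdeg, rfl⟩).trans
    (card_support_slice_le hr f)

end MultipleWeights

section OneRoot

variable {R : Type*} [CommRing R] [IsDomain R] {p : ℕ} [hp : Fact p.Prime] [CharP R p]

theorem card_support_X_sub_C_pow_le (b : R) (n : ℕ) :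
    ((X - C b) ^ n : R[X]).support.card ≤ n + 1 := by
  have h := card_supp_le_succ_natDegree ((X - C b) ^ n : R[X])
  rwa [natDegree_pow, natDegree_X_sub_C, mul_one] at h

theorem mem_lowerBounds_multipleWeights_pow {a : R} (ha : a ≠ 0) {t k c i : ℕ}
    (hi : p ^ t * (p * (p ^ k - 1) + c) < i) :
    (c + 2) * p ^ k ∈ lowerBounds (multipleWeights ((X - C a) ^ i) (p ^ (t + k + 1))) := by
  rintro w ⟨f, hf, hdvd, hdeg, rfl⟩
  have hle : i ≤ f.rootMultiplicity a := (le_rootMultiplicity_iff hf).2 hdvd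
  have hlt : f.rootMultiplicity a < p ^ (t + k + 1) := by
    have hle := natDegree_le_of_dvd (pow_rootMultiplicity_dvd f a) hf
    rw [natDegree_pow, natDegree_X_sub_C, mul_one] at hle
    exact hle.trans_lt ((natDegree_lt_iff_degree_lt hf).2 hdeg)
  exact (le_digitWeight hp.out.one_lt (hi.trans_le hle) hlt).trans
    (digitWeight_rootMultiplicity_le_card_support ha hf)

theorem exists_mem_multipleWeights_pow_le (a : R) {t k τ i : ℕ} (hτ : τ < p)
    (hi : i ≤ p ^ t * (p * (p ^ k - 1) + τ)) :
    ∃ w ∈ multipleWeights ((X - C a) ^ i) (p ^ (t + k + 1)), w ≤ (τ + 1) * p ^ k := by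
  have hpt : 0 < p ^ t := Nat.pow_pos hp.out.pos
  have hpk : 0 < p ^ k := Nat.pow_pos hp.out.pos
  refine ⟨_, ⟨(X - C a) ^ (p ^ t * (p * (p ^ k - 1) + τ)), pow_ne_zero _ (X_sub_C_ne_zero a),
    pow_dvd_pow _ hi, ?_, rfl⟩, ?_⟩
  · rw [degree_pow, degree_X_sub_C, nsmul_one, add_assoc, pow_add p t]
    have := mul_pow_sub_one_add hp.out.pos k
    exact Nat.cast_lt.2 (Nat.mul_lt_mul_of_pos_left (by omega) hpt)
  · have hsplit : p ^ t * (p * (p ^ k - 1) + τ) = p ^ t * τ + p ^ (t + 1) * (p ^ k - 1) := by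
      ring
    rw [hsplit, pow_add, X_sub_C_pow_char_pow_mul, X_sub_C_pow_char_pow_mul]
    refine card_support_mul_le.trans ?_
    rw [card_support_expand hpt, card_support_expand (Nat.pow_pos hp.out.pos)]
    refine Nat.mul_le_mul (card_support_X_sub_C_pow_le _ _)
      ((card_support_X_sub_C_pow_le _ _).trans ?_)
    omega

end OneRoot

section TwoRoots

variable {R : Type*} [CommRing R]

variable (R) in
/-- `d` is the least number of terms of a nonzero multiple of `(X - a) ^ i` of degree less than
`L`, whatever `a ≠ 0` is: the minimum distance of the one-root code with exponent `i`. -/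
def OneRootDistance (L i d : ℕ) : Prop :=
  ∀ a : R, a ≠ 0 → IsLeast (multipleWeights ((X - C a) ^ i) L) d

variable (R) in
/-- `d` is the least number of terms of a nonzero multiple of `(X - ξ) ^ i * (X + ξ) ^ j` of degree
less than `2 * L`, whatever `ξ ≠ 0` is: the minimum distance of the code with the two roots `ξ`
and `-ξ`. -/
def TwoRootDistance (L i j d : ℕ) : Prop :=
  ∀ ξ : R, ξ ≠ 0 → IsLeast (multipleWeights ((X - C ξ) ^ i * (X + C ξ) ^ j) (2 * L)) d

theorem TwoRootDistance.symm {L i j d : ℕ} (h : TwoRootDistance R L i j d) :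
    TwoRootDistance R L j i d := by
  intro ξ hξ
  have hneg := h (-ξ) (neg_ne_zero.2 hξ)
  rwa [C_neg, sub_neg_eq_add, ← sub_eq_add_neg, mul_comm] at hneg

theorem expand_two_X_sub_C_sq_pow (ξ : R) (n : ℕ) :
    expand R 2 ((X - C (ξ ^ 2)) ^ n) = (X - C ξ) ^ n * (X + C ξ) ^ n := by
  rw [← mul_pow, map_pow, map_sub, expand_X, expand_C, C_pow]
  ring

variable [IsDomain R]

/-- `X ^ m - a ^ m` has `a` as a simple root, so composing with `X ^ m` preserves the multiplicity
of the root. -/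
theorem X_sub_C_pow_dvd_of_dvd_expand {m n : ℕ} (hm : (m : R) ≠ 0) {a : R} (ha : a ≠ 0)
    {g : R[X]} (h : (X - C a) ^ n ∣ expand R m g) : (X - C (a ^ m)) ^ n ∣ g := by
  rcases eq_or_ne g 0 with rfl | hg
  · exact dvd_zero _
  obtain ⟨u, hu, hroot⟩ := exists_eq_pow_rootMultiplicity_mul_and_not_dvd g hg (a ^ m)
  rw [dvd_iff_isRoot, IsRoot.def] at hroot
  set q : R[X] := ∑ i ∈ Finset.range m, X ^ i * C a ^ (m - 1 - i)
  have hq : q.eval a ≠ 0 := by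
    have heval : q.eval a = m * a ^ (m - 1) := by
      simp only [q, eval_finsetSum, eval_mul, eval_pow, eval_X, eval_C, geom_sum₂_self]
    rw [heval]
    exact mul_ne_zero hm (pow_ne_zero _ ha)
  have hexpand : expand R m (X - C (a ^ m)) = (X - C a) * q := by
    rw [map_sub, expand_X, expand_C, C_pow, mul_comm]
    exact (geom_sum₂_mul X (C a) m).symm
  rw [hu, map_mul, map_pow, hexpand, mul_pow, mul_assoc] at h
  refine (pow_dvd_pow _ (le_of_X_sub_C_pow_dvd_pow_mul ?_ h)).trans
    (pow_rootMultiplicity_dvd g (a ^ m))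
  rw [eval_mul, eval_pow, expand_eval]
  exact mul_ne_zero (pow_ne_zero _ hq) hroot

theorem X_sub_C_pow_dvd_slice {m r n : ℕ} (hr : r < m) (hm : (m : R) ≠ 0) {a : R} (ha : a ≠ 0)
    {f : R[X]} (hf : ∀ i < m, i ≠ r → slice m i f = 0) (h : (X - C a) ^ n ∣ f) :
    (X - C (a ^ m)) ^ n ∣ slice m r f := by
  have hX : ¬ X - C a ∣ X ^ r := by simpa [dvd_iff_isRoot] using pow_ne_zero r ha
  rw [eq_X_pow_mul_expand_slice hr hf] at h
  exact X_sub_C_pow_dvd_of_dvd_expand hm ha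
    ((prime_X_sub_C a).pow_dvd_of_dvd_mul_left n hX h)

theorem mem_lowerBounds_multipleWeights_two_roots [NeZero (2 : R)] {ξ : R} (hξ : ξ ≠ 0)
    {i j L w d : ℕ} (hij : j ≤ i)
    (hw : w ∈ lowerBounds (multipleWeights ((X - C (ξ ^ 2)) ^ i) L))
    (hd : d ∈ lowerBounds (multipleWeights ((X - C (ξ ^ 2)) ^ j) L)) (hwd : w ≤ 2 * d) :
    w ∈ lowerBounds (multipleWeights ((X - C ξ) ^ i * (X + C ξ) ^ j) (2 * L)) := by
  rintro _ ⟨f, hf, hdvd, hdeg, rfl⟩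
  have hdeg' := fun r => degree_slice_lt two_pos r hdeg
  by_cases honly : ∃ r < 2, ∀ i < 2, i ≠ r → slice 2 i f = 0
  · obtain ⟨r, hr, hslice⟩ := honly
    have hne : slice 2 r f ≠ 0 := fun h0 => hf <| by
      rw [eq_X_pow_mul_expand_slice hr hslice, h0, map_zero, mul_zero]
    have hpow := X_sub_C_pow_dvd_slice hr (by exact_mod_cast two_ne_zero) hξ hslice
      ((dvd_mul_right _ _).trans hdvd)
    exact (hw ⟨_, hne, hpow, hdeg' r, rfl⟩).trans (card_support_slice_le hr f)
  · push Not at honly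
    have hexpand : expand R 2 ((X - C (ξ ^ 2)) ^ j) ∣ f := by
      rw [expand_two_X_sub_C_sq_pow]
      exact (mul_dvd_mul_right (pow_dvd_pow _ hij) _).trans hdvd
    have hle : ∀ r < 2, d ≤ (slice 2 r f).support.card := by
      intro r hr
      obtain ⟨i, hi, hir, hne⟩ := honly (1 - r) (by omega)
      obtain rfl : i = r := by omega
      exact hd ⟨_, hne, dvd_slice hr hexpand, hdeg' i, rfl⟩
    calc w ≤ 2 * d := hwd
      _ = (Finset.range 2).card • d := by rw [Finset.card_range, smul_eq_mul]
      _ ≤ ∑ r ∈ Finset.range 2, (slice 2 r f).support.card :=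
          Finset.card_nsmul_le_sum _ _ _ fun r hr => hle r (Finset.mem_range.1 hr)
      _ = f.support.card := sum_card_support_slice two_pos f

theorem OneRootDistance.two_root_max [NeZero (2 : R)] {L i j d₁ d₂ : ℕ}
    (h₁ : OneRootDistance R L i d₁) (h₂ : OneRootDistance R L j d₂) (hle : d₂ ≤ d₁)
    (hle' : d₁ ≤ 2 * d₂) : TwoRootDistance R L i j d₁ := by
  wlog hij : j ≤ i generalizing i j d₁ d₂
  · intro ξ hξ
    have hd : d₁ = d₂ := hle.antisymm' ((h₁ ξ hξ).2 (multipleWeights_subset_of_dvd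
      (pow_dvd_pow _ (not_le.1 hij).le) L (h₂ ξ hξ).1))
    subst hd
    exact (this h₂ h₁ le_rfl hle' (not_le.1 hij).le).symm ξ hξ
  intro ξ hξ
  have hleast := h₁ (ξ ^ 2) (pow_ne_zero 2 hξ)
  refine ⟨?_, mem_lowerBounds_multipleWeights_two_roots hξ hij hleast.2
    (h₂ (ξ ^ 2) (pow_ne_zero 2 hξ)).2 hle'⟩
  refine multipleWeights_subset_of_dvd (mul_dvd_mul_left _ (pow_dvd_pow _ hij)) _ ?_
  rw [← expand_two_X_sub_C_sq_pow]
  exact multipleWeights_subset_expand two_pos _ L hleast.1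

theorem exists_mem_multipleWeights_two_roots_le {p : ℕ} [hp : Fact p.Prime] [CharP R p]
    {s i j d : ℕ} {ξ : R} (hi : i ≤ p ^ s) (hd : d ∈ multipleWeights ((X + C ξ) ^ j) (p ^ s)) :
    ∃ w ∈ multipleWeights ((X - C ξ) ^ i * (X + C ξ) ^ j) (2 * p ^ s), w ≤ 2 * d := by
  obtain ⟨u, hu, hdvd, hdeg, rfl⟩ := hd
  have hpow : (X - C ξ) ^ p ^ s ≠ 0 := pow_ne_zero _ (X_sub_C_ne_zero ξ)
  refine ⟨_, ⟨(X - C ξ) ^ p ^ s * u, mul_ne_zero hpow hu, mul_dvd_mul (pow_dvd_pow _ hi) hdvd,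
    ?_, rfl⟩, ?_⟩
  · rw [← natDegree_lt_iff_degree_lt hu] at hdeg
    rw [← natDegree_lt_iff_degree_lt (mul_ne_zero hpow hu), natDegree_mul hpow hu,
      natDegree_pow, natDegree_X_sub_C]
    omega
  · refine card_support_mul_le.trans (Nat.mul_le_mul_right _ ?_)
    have hexpand := X_sub_C_pow_char_pow_mul p ξ s 1
    rw [mul_one] at hexpand
    rw [hexpand, card_support_expand (Nat.pow_pos hp.out.pos)]
    exact card_support_X_sub_C_pow_le _ 1

theorem OneRootDistance.two_root_two_mul [NeZero (2 : R)] {p : ℕ} [Fact p.Prime] [CharP R p]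
    {s i j d : ℕ} (hi : i ≤ p ^ s) (h : OneRootDistance R (p ^ s) j d)
    (hlow : ∀ a : R, a ≠ 0 → 2 * d ∈ lowerBounds (multipleWeights ((X - C a) ^ i) (p ^ s))) :
    TwoRootDistance R (p ^ s) i j (2 * d) := by
  intro ξ hξ
  have hij : j ≤ i := by
    by_contra! hlt
    have hmem := (h ξ hξ).1
    have := pos_of_mem_multipleWeights hmem
    have := hlow ξ hξ (multipleWeights_subset_of_dvd (pow_dvd_pow _ hlt.le) _ hmem)
    omega
  have hbound := mem_lowerBounds_multipleWeights_two_roots hξ hij (hlow _ (pow_ne_zero 2 hξ))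
    (h _ (pow_ne_zero 2 hξ)).2 le_rfl
  have hneg := (h (-ξ) (neg_ne_zero.2 hξ)).1
  rw [C_neg, sub_neg_eq_add] at hneg
  obtain ⟨w, hw, hle⟩ := exists_mem_multipleWeights_two_roots_le hi hneg
  obtain rfl : w = 2 * d := hle.antisymm (hbound hw)
  exact ⟨hw, hbound⟩

theorem OneRootDistance.two_root_min [NeZero (2 : R)] {p : ℕ} [Fact p.Prime] [CharP R p]
    {s i j d₁ d₂ : ℕ} (hi : i ≤ p ^ s) (h₁ : OneRootDistance R (p ^ s) i d₁)
    (h₂ : OneRootDistance R (p ^ s) j d₂) (hle : d₂ ≤ d₁) :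
    TwoRootDistance R (p ^ s) i j (min d₁ (2 * d₂)) := by
  rcases le_total d₁ (2 * d₂) with h | h
  · rw [min_eq_left h]
    exact h₁.two_root_max h₂ hle h
  · rw [min_eq_right h]
    exact h₂.two_root_two_mul hi fun a ha _ hw => h.trans ((h₁ a ha).2 hw)

theorem OneRootDistance.two_root_full [NeZero (2 : R)] {p : ℕ} [Fact p.Prime] [CharP R p]
    {s j d : ℕ} (h : OneRootDistance R (p ^ s) j d) :
    TwoRootDistance R (p ^ s) (p ^ s) j (2 * d) := by
  refine h.two_root_two_mul le_rfl fun a _ => ?_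
  rintro _ ⟨f, hf, hdvd, hdeg, -⟩
  have hle := degree_le_of_dvd hdvd hf
  rw [degree_pow, degree_X_sub_C, nsmul_one] at hle
  exact absurd hdeg hle.not_gt

end TwoRoots

section Blocks

variable {p s k τ i : ℕ}

/-- The block of exponents with parameters `k < s` and `1 ≤ τ < p`, uniformly in `k`: it is
`T_{k,τ}` for `k ≥ 1` and `B_{τ-1}` for `k = 0`, with `B_0 = {1, …, p ^ (s - 1)}`. -/
structure InBlock (p s k τ i : ℕ) : Prop where
  level_lt : k < s
  one_le : 1 ≤ τ
  lt_char : τ < p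
  inTauBlock : InTauBlock p s k τ i

theorem InBetaBlock.inBlock {β : ℕ} (hs : 0 < s) (hβ : β + 1 < p) (h : InBetaBlock p s β i) :
    InBlock p s 0 (β + 1) i :=
  ⟨hs, Nat.succ_pos β, hβ, by simpa [InTauBlock, InBetaBlock] using h⟩

theorem InTauBlock.inBlock (hk : 1 ≤ k) (hk' : k ≤ s - 1) (hτ : 1 ≤ τ) (hτ' : τ ≤ p - 1)
    (h : InTauBlock p s k τ i) : InBlock p s k τ i :=
  ⟨by omega, hτ, by omega, h⟩

theorem InBlock.inBetaBlock (h : InBlock p s 0 τ i) : InBetaBlock p s (τ - 1) i := by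
  simpa [InTauBlock, InBetaBlock, Nat.sub_add_cancel h.one_le] using h.inTauBlock

theorem inBlock_of_le_pow (hp : 1 < p) (hs : 0 < s) (hi : 0 < i) (hi' : i ≤ p ^ (s - 1)) :
    InBlock p s 0 1 i :=
  InBetaBlock.inBlock (β := 0) hs hp ⟨by omega, by omega⟩

theorem InBlock.exists_eq (h : InBlock p s k τ i) : ∃ t, s = t + k + 1 :=
  ⟨s - k - 1, by have := h.level_lt; omega⟩

theorem inTauBlock_iff {t : ℕ} : InTauBlock p (t + k + 1) k τ i ↔
    p ^ t * (p * (p ^ k - 1) + (τ - 1)) < i ∧ i ≤ p ^ t * (p * (p ^ k - 1) + τ) := by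
  have hadd (c : ℕ) : p ^ (t + k + 1) - p ^ (t + 1) + c * p ^ t =
      p ^ t * (p * (p ^ k - 1) + c) := by
    rw [Nat.mul_sub, mul_add, Nat.mul_sub, mul_comm c]
    ring_nf
  have hk : t + k + 1 - k = t + 1 := by omega
  rw [InTauBlock, hk, Nat.add_sub_cancel, hadd, hadd, Nat.succ_le_iff]

theorem InBlock.lt_pow (h : InBlock p s k τ i) : i < p ^ s := by
  obtain ⟨t, rfl⟩ := h.exists_eq
  have hp : 0 < p := (Nat.zero_le τ).trans_lt h.lt_char
  have hadd := mul_pow_sub_one_add hp k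
  calc i ≤ p ^ t * (p * (p ^ k - 1) + τ) := (inTauBlock_iff.1 h.inTauBlock).2
    _ < p ^ t * p ^ (k + 1) :=
        Nat.mul_lt_mul_of_pos_left (by have := h.lt_char; omega) (Nat.pow_pos hp)
    _ = p ^ (t + k + 1) := by ring

/-- With `p ^ t ≤ p ^ s - i < p ^ (t + 1)`, the level of `i` is `s - t - 1`, and `τ` is read off
the quotient of `i - 1` by `p ^ t`. -/
theorem exists_inBlock (hp : 1 < p) (hi : 0 < i) (his : i < p ^ s) :
    ∃ k τ, InBlock p s k τ i := by
  obtain ⟨t, hlog, hlog'⟩ : ∃ t, p ^ t ≤ p ^ s - i ∧ p ^ s - i < p ^ (t + 1) :=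
    ⟨Nat.log p _, Nat.pow_log_le_self p (by omega), Nat.lt_pow_succ_log_self hp _⟩
  have hts : t < s := (Nat.pow_lt_pow_iff_right hp).1 (by omega)
  obtain ⟨k, rfl⟩ := Nat.exists_eq_add_of_lt hts
  have hpt : 0 < p ^ t := by positivity
  have hadd := mul_pow_sub_one_add (by omega : 0 < p) k
  have hpow : p ^ (t + k + 1) = p ^ t * (p * (p ^ k - 1)) + p ^ (t + 1) := by
    rw [add_assoc, pow_add, ← hadd]
    ring
  obtain ⟨q, hq, hq'⟩ : ∃ q, p ^ t * q ≤ i - 1 ∧ i - 1 < p ^ t * (q + 1) :=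
    ⟨(i - 1) / p ^ t, Nat.mul_div_le _ _, Nat.lt_mul_div_succ _ hpt⟩
  have hlow : p * (p ^ k - 1) ≤ q :=
    Nat.lt_succ_iff.1 (lt_of_mul_lt_mul_left (lt_of_le_of_lt (by omega) hq') hpt.le)
  have hhigh : q + 1 < p * (p ^ k - 1) + p := by
    have hsum : p ^ t * (q + 1) < p ^ t * (p * (p ^ k - 1) + p) := by
      rw [hadd, ← pow_add, ← add_assoc, mul_add, mul_one]
      omega
    exact lt_of_mul_lt_mul_left hsum hpt.le
  refine ⟨k, q - p * (p ^ k - 1) + 1, by omega, by omega, by omega, inTauBlock_iff.2 ?_⟩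
  rw [Nat.add_sub_cancel, ← add_assoc, Nat.add_sub_cancel' hlow]
  omega

end Blocks

section Table

theorem three_le_char (R : Type*) [CommRing R] [NeZero (2 : R)] (p : ℕ) [hp : Fact p.Prime]
    [CharP R p] : 3 ≤ p := by
  refine lt_of_le_of_ne hp.out.two_le ?_
  rintro rfl
  exact two_ne_zero (CharP.cast_eq_zero R 2)

theorem oneRootDistance_zero {R : Type*} [CommRing R] [Nontrivial R] {L : ℕ} (hL : 0 < L) :
    OneRootDistance R L 0 1 := by
  intro a _
  refine ⟨⟨1, one_ne_zero, by rw [pow_zero], ?_, ?_⟩, fun w hw => pos_of_mem_multipleWeights hw⟩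
  · rw [degree_one]
    exact_mod_cast hL
  · rw [← C_1, support_C one_ne_zero, Finset.card_singleton]

variable {R : Type*} [CommRing R] [IsDomain R] {p : ℕ} [hp : Fact p.Prime] [CharP R p]
  {s k k' τ τ' i j : ℕ}

theorem InBlock.oneRootDistance (h : InBlock p s k τ i) :
    OneRootDistance R (p ^ s) i ((τ + 1) * p ^ k) := by
  obtain ⟨t, rfl⟩ := h.exists_eq
  obtain ⟨hlow, hhigh⟩ := inTauBlock_iff.1 h.inTauBlock
  intro a ha
  have hbound := mem_lowerBounds_multipleWeights_pow ha hlow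
  rw [show τ - 1 + 2 = τ + 1 by have := h.one_le; omega] at hbound
  obtain ⟨w, hw, hle⟩ := exists_mem_multipleWeights_pow_le a h.lt_char hhigh
  obtain rfl := hle.antisymm (hbound hw)
  exact ⟨hw, hbound⟩

variable [NeZero (2 : R)]

theorem twoRootDistance_right_zero (hs : 0 < s) (hi : 0 < i) (hi' : i ≤ p ^ s) :
    TwoRootDistance R (p ^ s) i 0 2 := by
  obtain ⟨t, rfl⟩ := Nat.exists_eq_add_of_lt hs
  refine (oneRootDistance_zero (Nat.pow_pos hp.out.pos)).two_root_two_mul hi' fun a ha => ?_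
  simpa using mem_lowerBounds_multipleWeights_pow ha (t := t) (k := 0) (c := 0) (by simpa using hi)

theorem twoRootDistance_four (hi : 2 * p ^ (s - 1) < i) (hi' : i ≤ p ^ s)
    (hj : InBlock p s 0 1 j) : TwoRootDistance R (p ^ s) i j 4 := by
  obtain ⟨t, rfl⟩ := hj.exists_eq
  have hdist := hj.oneRootDistance (R := R)
  refine hdist.two_root_two_mul hi' fun a ha => ?_
  rw [mul_comm] at hi
  simpa using mem_lowerBounds_multipleWeights_pow ha (t := t) (k := 0) (c := 2) (by simpa using hi)

theorem InBlock.twoRootDistance_of_level_eq (hi : InBlock p s k τ i) (hj : InBlock p s k τ' j)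
    (hτ : τ' ≤ τ) :
    TwoRootDistance R (p ^ s) i j (min ((τ + 1) * p ^ k) (2 * ((τ' + 1) * p ^ k))) :=
  hi.oneRootDistance.two_root_min hi.lt_pow.le hj.oneRootDistance
    (Nat.mul_le_mul_right _ (Nat.succ_le_succ hτ))

theorem InBlock.twoRootDistance_of_level_lt (hi : InBlock p s k τ i) (hj : InBlock p s k' τ' j)
    (hk : k' < k) : TwoRootDistance R (p ^ s) i j (2 * ((τ' + 1) * p ^ k')) := by
  refine hj.oneRootDistance.two_root_two_mul hi.lt_pow.le fun a ha w hw =>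
    le_trans ?_ ((hi.oneRootDistance a ha).2 hw)
  calc 2 * ((τ' + 1) * p ^ k') ≤ (τ + 1) * p ^ (k' + 1) := by
        rw [pow_succ']
        exact Nat.mul_le_mul (Nat.succ_le_succ hi.one_le) (Nat.mul_le_mul_right _ hj.lt_char)
    _ ≤ (τ + 1) * p ^ k := Nat.mul_le_mul_left _ (Nat.pow_le_pow_right hp.out.pos hk)

theorem twoRootDistance_of_le_pow (hs : 0 < s) (hi : i ≤ p ^ (s - 1)) (hj : j ≤ p ^ (s - 1))
    (h0 : (i, j) ≠ (0, 0)) : TwoRootDistance R (p ^ s) i j 2 := by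
  have hle : p ^ (s - 1) ≤ p ^ s := Nat.pow_le_pow_right hp.out.pos (Nat.sub_le s 1)
  rcases Nat.eq_zero_or_pos j with rfl | hj0
  · refine twoRootDistance_right_zero hs (Nat.pos_of_ne_zero ?_) (hi.trans hle)
    rintro rfl
    exact h0 rfl
  rcases Nat.eq_zero_or_pos i with rfl | hi0
  · exact (twoRootDistance_right_zero hs hj0 (hj.trans hle)).symm
  have hi' := inBlock_of_le_pow hp.out.one_lt hs hi0 hi
  have hj' := inBlock_of_le_pow hp.out.one_lt hs hj0 hj
  simpa using hi'.twoRootDistance_of_level_eq (R := R) hj' le_rfl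

theorem DistanceTable.twoRootDistance (hs : 0 < s) {d : ℕ} (h : DistanceTable p s i j d)
    (h0 : (i, j) ≠ (0, 0)) : TwoRootDistance R (p ^ s) i j d := by
  have hp3 := three_le_char R p
  cases h with
  | right_zero _ hi hi' => exact twoRootDistance_right_zero hs hi hi'
  | both_small _ _ hi hj => exact twoRootDistance_of_le_pow hs hi hj h0
  | three _ _ hi hi' hj hj' =>
    have hiB : InBlock p s 0 2 i :=
      InBetaBlock.inBlock (β := 1) hs hp3 ⟨by omega, by omega⟩
    have hjB := inBlock_of_le_pow hp.out.one_lt hs hj hj'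
    simpa using hiB.twoRootDistance_of_level_eq (R := R) hjB one_le_two
  | four _ _ hi hi' hj hj' =>
    exact twoRootDistance_four hi hi' (inBlock_of_le_pow hp.out.one_lt hs hj hj')
  | beta_beta _ _ β β' _ hβ hβp hi hj =>
    simpa using (hi.inBlock hs (by omega)).twoRootDistance_of_level_eq (R := R)
      (hj.inBlock hs (by omega)) (Nat.succ_le_succ hβ)
  | tau_beta _ _ k τ β hk hk' hτ hτ' _ hβ hi hj =>
    simpa using (hi.inBlock hk hk' hτ hτ').twoRootDistance_of_level_lt (R := R)
      (hj.inBlock hs (by omega)) hk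
  | tau_eq _ _ k τ hk hk' hτ hτ' hi hj =>
    have hdist := (hi.inBlock hk hk' hτ hτ').twoRootDistance_of_level_eq (R := R)
      (hj.inBlock hk hk' hτ hτ') le_rfl
    rwa [min_eq_left (by omega)] at hdist
  | tau_lt _ _ k τ₁ τ₂ hk hk' hτ₂ hτ hτ₁ hi hj =>
    rw [min_comm, mul_assoc]
    exact (hi.inBlock hk hk' (by omega) hτ₁).twoRootDistance_of_level_eq
      (hj.inBlock hk hk' hτ₂ (by omega)) hτ.le
  | level_lt _ _ k' k'' τ₃ τ₄ hk'' hk hk' hτ₃ hτ₃' hτ₄ hτ₄' hi hj =>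
    rw [mul_assoc]
    exact (hi.inBlock (by omega) hk' hτ₃ hτ₃').twoRootDistance_of_level_lt
      (hj.inBlock hk'' (by omega) hτ₄ hτ₄') hk
  | full_beta _ β _ hβ hj =>
    simpa using (hj.inBlock hs (by omega)).oneRootDistance.two_root_full (R := R)
  | full_tau _ k τ hk hk' hτ hτ' hj =>
    rw [mul_assoc]
    exact (hj.inBlock hk hk' hτ hτ').oneRootDistance.two_root_full

end Table

section Exhaustion

variable {p s k k' τ τ' i j : ℕ}

theorem exists_distanceTable_of_le_pow (hi : 0 < i) (hi' : i ≤ p ^ s) (hj : j ≤ p ^ (s - 1)) :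
    ∃ d, DistanceTable p s i j d := by
  rcases Nat.eq_zero_or_pos j with rfl | hj0
  · exact ⟨_, .right_zero i hi hi'⟩
  rcases le_or_gt i (p ^ (s - 1)) with h₁ | h₁
  · exact ⟨_, .both_small i j h₁ hj⟩
  rcases le_or_gt i (2 * p ^ (s - 1)) with h₂ | h₂
  · exact ⟨_, .three i j h₁ h₂ hj0 hj⟩
  · exact ⟨_, .four i j h₂ hi' hj0 hj⟩

theorem exists_distanceTable_of_inBlock (hi : InBlock p s k τ i) (hj : InBlock p s k' τ' j)
    (hlex : k' < k ∨ k' = k ∧ τ' ≤ τ) : ∃ d, DistanceTable p s i j d := by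
  have ⟨hk, hτ, hτp, hiT⟩ := hi
  have ⟨hk', hτ', hτp', hjT⟩ := hj
  rcases Nat.eq_zero_or_pos k' with rfl | hk'0
  · have hjB := hj.inBetaBlock
    rcases Nat.eq_or_lt_of_le hτ' with rfl | hτ'1
    · refine exists_distanceTable_of_le_pow ?_ hi.lt_pow.le (by simpa using hjB.2)
      exact (Nat.succ_pos _).trans_le hiT.1
    rcases Nat.eq_zero_or_pos k with rfl | hk0
    · exact ⟨_, .beta_beta i j (τ - 1) (τ' - 1) (by omega) (by omega) (by omega)
        hi.inBetaBlock hjB⟩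
    · exact ⟨_, .tau_beta i j k τ (τ' - 1) hk0 (by omega) hτ (by omega) (by omega) (by omega)
        hiT hjB⟩
  rcases hlex with hlt | ⟨rfl, hle⟩
  · exact ⟨_, .level_lt i j k k' τ τ' hk'0 hlt (by omega) hτ (by omega) hτ' (by omega) hiT hjT⟩
  rcases Nat.eq_or_lt_of_le hle with rfl | hlt
  · exact ⟨_, .tau_eq i j k' τ' hk'0 (by omega) hτ (by omega) hiT hjT⟩
  · exact ⟨_, .tau_lt i j k' τ τ' hk'0 (by omega) hτ' hlt (by omega) hiT hjT⟩

theorem exists_distanceTable_full_of_inBlock (hj : InBlock p s k τ j) :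
    ∃ d, DistanceTable p s (p ^ s) j d := by
  have ⟨hk, hτ, hτp, hjT⟩ := hj
  rcases Nat.eq_zero_or_pos k with rfl | hk0
  · have hjB := hj.inBetaBlock
    rcases Nat.eq_or_lt_of_le hτ with rfl | hτ1
    · exact exists_distanceTable_of_le_pow (Nat.pow_pos (by omega)) le_rfl (by simpa using hjB.2)
    · exact ⟨_, .full_beta j (τ - 1) (by omega) (by omega) hjB⟩
  · exact ⟨_, .full_tau j k τ hk0 (by omega) hτ (by omega) hjT⟩

theorem exists_distanceTable_full (hp : 1 < p) (hj : j < p ^ s) :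
    ∃ d, DistanceTable p s (p ^ s) j d := by
  rcases Nat.eq_zero_or_pos j with rfl | hj0
  · exact ⟨_, .right_zero _ hj le_rfl⟩
  · obtain ⟨k, τ, hjB⟩ := exists_inBlock hp hj0 hj
    exact exists_distanceTable_full_of_inBlock hjB

theorem exists_distanceTable (hp : 1 < p) (hi : i ≤ p ^ s) (hj : j ≤ p ^ s)
    (h0 : (i, j) ≠ (0, 0)) (h1 : (i, j) ≠ (p ^ s, p ^ s)) :
    ∃ d, DistanceTable p s i j d ∨ DistanceTable p s j i d := by
  rw [exists_or]
  rcases Nat.eq_or_lt_of_le hi with rfl | hi'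
  · exact .inl (exists_distanceTable_full hp (lt_of_le_of_ne hj fun h => h1 (by rw [h])))
  rcases Nat.eq_or_lt_of_le hj with rfl | hj'
  · exact .inr (exists_distanceTable_full hp hi')
  rcases Nat.eq_zero_or_pos i with rfl | hi0
  · exact .inr ⟨_, .right_zero j (Nat.pos_of_ne_zero fun h => h0 (by rw [h])) hj⟩
  rcases Nat.eq_zero_or_pos j with rfl | hj0
  · exact .inl ⟨_, .right_zero i hi0 hi⟩
  obtain ⟨k, τ, hiB⟩ := exists_inBlock hp hi0 hi'
  obtain ⟨k', τ', hjB⟩ := exists_inBlock hp hj0 hj'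
  by_cases hlex : k' < k ∨ k' = k ∧ τ' ≤ τ
  · exact .inl (exists_distanceTable_of_inBlock hiB hjB hlex)
  · exact .inr (exists_distanceTable_of_inBlock hjB hiB (by omega))

end Exhaustion

section Ideals

theorem exists_dvd_eq_span_mk {R : Type*} [CommRing R] [IsPrincipalIdealRing R] {q : R}
    (I : Ideal (R ⧸ Ideal.span {q})) :
    ∃ g, g ∣ q ∧ I = Ideal.span {Ideal.Quotient.mk (Ideal.span {q}) g} := by
  set π := Ideal.Quotient.mk (Ideal.span {q})
  obtain ⟨g, hg⟩ := (IsPrincipalIdealRing.principal (I.comap π)).principal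
  rw [Ideal.submodule_span_eq] at hg
  refine ⟨g, ?_, ?_⟩
  · rw [← Ideal.mem_span_singleton, ← hg, Ideal.mem_comap,
      Ideal.Quotient.eq_zero_iff_mem.2 (Ideal.mem_span_singleton_self q)]
    exact I.zero_mem
  · rw [← Set.image_singleton, ← Ideal.map_span, ← hg,
      Ideal.map_comap_of_surjective _ Ideal.Quotient.mk_surjective]

theorem mk_mem_span_mk_iff_dvd {R : Type*} [CommRing R] {q g : R} (hg : g ∣ q) (f : R) :
    Ideal.Quotient.mk (Ideal.span {q}) f ∈ Ideal.span {Ideal.Quotient.mk (Ideal.span {q}) g} ↔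
      g ∣ f := by
  rw [← Set.image_singleton, ← Ideal.map_span, Ideal.mem_quotient_iff_mem
    (Ideal.span_singleton_le_span_singleton.2 hg), Ideal.mem_span_singleton]

theorem exists_associated_of_dvd_pow_mul_pow {M : Type*} [CommMonoidWithZero M]
    [IsCancelMulZero M] [DecompositionMonoid M] {a b g : M} (ha : Prime a) (hb : Prime b)
    {m n : ℕ} (h : g ∣ a ^ m * b ^ n) : ∃ i ≤ m, ∃ j ≤ n, Associated g (a ^ i * b ^ j) := by
  obtain ⟨u, v, hu, hv, rfl⟩ := exists_dvd_and_dvd_of_dvd_mul h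
  obtain ⟨i, hi, hui⟩ := (dvd_prime_pow ha m).1 hu
  obtain ⟨j, hj, hvj⟩ := (dvd_prime_pow hb n).1 hv
  exact ⟨i, hi, j, hj, hui.mul_mul hvj⟩

end Ideals

section Words

variable {R : Type*} [Semiring R] [DecidableEq R] {N : ℕ}

theorem hammingNorm_eq_card_support_ofFn (c : Fin N → R) :
    hammingNorm c = (ofFn N c).support.card := by
  rw [hammingNorm, ← Finset.card_map Fin.valEmbedding]
  congr 1
  ext k
  simp only [Finset.mem_map, Finset.mem_filter, Finset.mem_univ, true_and, mem_support_iff,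
    Fin.valEmbedding_apply]
  constructor
  · rintro ⟨i, hi, rfl⟩
    rwa [ofFn_coeff_eq_val_of_lt c i.isLt]
  · intro hk
    have hkN : k < N := by
      by_contra! hle
      exact hk (ofFn_coeff_eq_zero_of_ge c hle)
    exact ⟨⟨k, hkN⟩, by rwa [ofFn_coeff_eq_val_of_lt c hkN] at hk, rfl⟩

theorem ofFn_toFn_of_degree_lt {f : R[X]} (h : f.degree < N) : ofFn N (toFn N f) = f := by
  rw [degree_lt_iff_coeff_zero] at h
  ext k
  rcases lt_or_ge k N with hk | hk
  · rw [ofFn_coeff_eq_val_of_lt _ hk]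
    rfl
  · rw [ofFn_coeff_eq_zero_of_ge _ hk, h k hk]

end Words

section Codes

variable {F : Type*} [Field F] {N : ℕ} {lam : F}

theorem wordClass_eq_mk_ofFn [DecidableEq F] (c : Fin N → F) :
    wordClass N lam c = Ideal.Quotient.mk (Ideal.span {(X ^ N - C lam : F[X])}) (ofFn N c) := by
  rw [ofFn_eq_sum_monomial, map_sum, wordClass, Fintype.linearCombination_apply]
  refine Finset.sum_congr rfl fun i _ => ?_
  rw [← C_mul_X_pow_eq_monomial, ← smul_eq_C_mul]
  rfl

theorem wordClass_injective (hN : 0 < N) : Function.Injective (wordClass N lam) := by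
  classical
  rw [injective_iff_map_eq_zero]
  intro c hc
  rw [wordClass_eq_mk_ofFn, Ideal.Quotient.eq_zero_iff_dvd] at hc
  have hzero := eq_zero_of_dvd_of_degree_lt hc
    ((ofFn_degree_lt c).trans_eq (degree_X_pow_sub_C hN lam).symm)
  exact injective_ofFn N (hzero.trans (map_zero _).symm)

theorem X_mul_ofFn [DecidableEq F] (hN : 0 < N) (lam : F) (c : Fin N → F) :
    X * ofFn N c = ofFn N (constaShift lam c) +
      (X ^ N - C lam) * C (c ⟨N - 1, Nat.sub_one_lt_of_lt hN⟩) := by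
  ext k
  rw [coeff_add, coeff_mul_C, coeff_sub, coeff_X_pow, coeff_C]
  rcases k with _ | k
  · rw [mul_comm, coeff_mul_X_zero, ofFn_coeff_eq_val_of_lt _ hN, if_neg (by omega)]
    simp [constaShift]
  rw [coeff_X_mul]
  rcases lt_trichotomy (k + 1) N with h | h | h
  · rw [ofFn_coeff_eq_val_of_lt _ h, ofFn_coeff_eq_val_of_lt _ (by omega), if_neg (by omega)]
    simp [constaShift]
  · subst h
    rw [ofFn_coeff_eq_zero_of_ge _ le_rfl, ofFn_coeff_eq_val_of_lt _ (by omega)]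
    simp
  · rw [ofFn_coeff_eq_zero_of_ge _ h.le, ofFn_coeff_eq_zero_of_ge _ (by omega),
      if_neg (by omega)]
    simp

theorem wordClass_constaShift (hN : 0 < N) (c : Fin N → F) :
    wordClass N lam (constaShift lam c) =
      Ideal.Quotient.mk (Ideal.span {(X ^ N - C lam : F[X])}) X * wordClass N lam c := by
  classical
  rw [wordClass_eq_mk_ofFn, wordClass_eq_mk_ofFn, ← map_mul, X_mul_ofFn hN lam c, eq_comm,
    Ideal.Quotient.eq, add_sub_cancel_left, Ideal.mem_span_singleton]
  exact dvd_mul_right _ _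

theorem isConstacyclic_codeOfIdeal (hN : 0 < N) (I : Ideal (Ambient N lam)) :
    IsConstacyclic lam (codeOfIdeal I) := by
  intro c hc
  change wordClass N lam (constaShift lam c) ∈ I
  rw [wordClass_constaShift hN]
  exact I.mul_mem_left _ hc

theorem IsConstacyclic.mk_mul_mem_map (hN : 0 < N) {D : Submodule F (Fin N → F)}
    (hD : IsConstacyclic lam D) (g : F[X]) {x : Ambient N lam}
    (hx : x ∈ D.map (wordClass N lam)) :
    Ideal.Quotient.mk (Ideal.span {(X ^ N - C lam : F[X])}) g * x ∈ D.map (wordClass N lam) := by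
  induction g using Polynomial.induction_on' with
  | add g h hg hh =>
    rw [map_add, add_mul]
    exact Submodule.add_mem _ hg hh
  | monomial n a =>
    rw [← C_mul_X_pow_eq_monomial, ← smul_eq_C_mul]
    suffices Ideal.Quotient.mk (Ideal.span {(X ^ N - C lam : F[X])}) (X ^ n) * x ∈
        D.map (wordClass N lam) from by
      have hsmul := Submodule.smul_mem _ a this
      rwa [← smul_mul_assoc] at hsmul
    induction n with
    | zero => simpa using hx
    | succ n ih =>
      obtain ⟨c, hc, hcx⟩ := ih
      rw [pow_succ', map_mul, mul_assoc, ← hcx, ← wordClass_constaShift hN]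
      exact Submodule.mem_map_of_mem (hD c hc)

theorem isConstacyclic_iff_exists_codeOfIdeal (hN : 0 < N) {D : Submodule F (Fin N → F)} :
    IsConstacyclic lam D ↔ ∃ I : Ideal (Ambient N lam), D = codeOfIdeal I := by
  constructor
  · intro hD
    let I : Ideal (Ambient N lam) :=
      { (D.map (wordClass N lam)).toAddSubmonoid with
        smul_mem' := by
          intro y x hx
          obtain ⟨g, rfl⟩ := Ideal.Quotient.mk_surjective y
          exact hD.mk_mul_mem_map hN g hx }
    exact ⟨I, (Submodule.comap_map_eq_of_injective (wordClass_injective hN) D).symm⟩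
  · rintro ⟨I, rfl⟩
    exact isConstacyclic_codeOfIdeal hN I

theorem codeOfIdeal_top : codeOfIdeal (⊤ : Ideal (Ambient N lam)) = ⊤ := rfl

theorem codeOfIdeal_bot (hN : 0 < N) : codeOfIdeal (⊥ : Ideal (Ambient N lam)) = ⊥ :=
  LinearMap.ker_eq_bot.2 (wordClass_injective hN)

theorem mem_codeOfIdeal_span_iff_dvd [DecidableEq F] {G : F[X]} (hG : G ∣ X ^ N - C lam)
    (c : Fin N → F) :
    c ∈ codeOfIdeal (Ideal.span
      {Ideal.Quotient.mk (Ideal.span {(X ^ N - C lam : F[X])}) G}) ↔ G ∣ ofFn N c := by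
  change wordClass N lam c ∈ Ideal.span _ ↔ _
  rw [wordClass_eq_mk_ofFn, mk_mem_span_mk_iff_dvd hG]

theorem hasHammingDistance_codeOfIdeal_span [DecidableEq F] {G : F[X]} (hG : G ∣ X ^ N - C lam)
    {d : ℕ} (h : IsLeast (multipleWeights G N) d) :
    HasHammingDistance (codeOfIdeal (Ideal.span
      {Ideal.Quotient.mk (Ideal.span {(X ^ N - C lam : F[X])}) G})) d := by
  rw [HasHammingDistance]
  convert h using 1
  ext w
  constructor
  · rintro ⟨c, hc, hc0, rfl⟩
    exact ⟨ofFn N c, (map_ne_zero_iff _ (injective_ofFn N)).2 hc0,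
      (mem_codeOfIdeal_span_iff_dvd hG c).1 hc, ofFn_degree_lt c,
      (hammingNorm_eq_card_support_ofFn c).symm⟩
  · rintro ⟨f, hf, hGf, hdeg, rfl⟩
    have hof := ofFn_toFn_of_degree_lt hdeg
    refine ⟨toFn N f, (mem_codeOfIdeal_span_iff_dvd hG _).2 (by rwa [hof]), ?_, ?_⟩
    · rw [← map_ne_zero_iff _ (injective_ofFn N), hof]
      exact hf
    · rw [hammingNorm_eq_card_support_ofFn, hof]

variable {η n : ℕ} {ξ : F}

theorem isConstacyclic_iff_exists_codeIJ (hN : 0 < N)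
    (hq : (X ^ N - C lam : F[X]) = (X ^ η - C ξ) ^ n * (X ^ η + C ξ) ^ n)
    (hA : Irreducible (X ^ η - C ξ : F[X])) (hB : Irreducible (X ^ η + C ξ : F[X]))
    (D : Submodule F (Fin N → F)) :
    IsConstacyclic lam D ↔ ∃ i ≤ n, ∃ j ≤ n, D = codeIJ N lam η ξ i j := by
  rw [isConstacyclic_iff_exists_codeOfIdeal hN]
  constructor
  · rintro ⟨I, rfl⟩
    obtain ⟨G, hG, rfl⟩ := exists_dvd_eq_span_mk I
    obtain ⟨i, hi, j, hj, hass⟩ :=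
      exists_associated_of_dvd_pow_mul_pow hA.prime hB.prime (hq ▸ hG)
    have hass' := hass.map (Ideal.Quotient.mk (Ideal.span {(X ^ N - C lam : F[X])}))
    exact ⟨i, hi, j, hj, congrArg codeOfIdeal
      (le_antisymm (Ideal.span_singleton_le_span_singleton.2 hass'.dvd')
        (Ideal.span_singleton_le_span_singleton.2 hass'.dvd))⟩
  · rintro ⟨i, -, j, -, rfl⟩
    exact ⟨_, rfl⟩

theorem codeIJ_zero_zero : codeIJ N lam η ξ 0 0 = ⊤ := by
  rw [codeIJ, pow_zero, pow_zero, one_mul, map_one, Ideal.span_singleton_one, codeOfIdeal_top]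

theorem codeIJ_self (hN : 0 < N)
    (hq : (X ^ N - C lam : F[X]) = (X ^ η - C ξ) ^ n * (X ^ η + C ξ) ^ n) :
    codeIJ N lam η ξ n n = ⊥ := by
  rw [codeIJ, ← hq, Ideal.Quotient.eq_zero_iff_dvd _ _ |>.2 dvd_rfl, Ideal.span_singleton_zero,
    codeOfIdeal_bot hN]

theorem hasHammingDistance_codeIJ [DecidableEq F] {i j d : ℕ} (hη : 0 < η) (hξ : ξ ≠ 0)
    (hq : (X ^ (2 * η * n) - C lam : F[X]) = (X ^ η - C ξ) ^ n * (X ^ η + C ξ) ^ n)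
    (hi : i ≤ n) (hj : j ≤ n) (h : TwoRootDistance F n i j d) :
    HasHammingDistance (codeIJ (2 * η * n) lam η ξ i j) d := by
  have hG : expand F η ((X - C ξ) ^ i * (X + C ξ) ^ j) =
      (X ^ η - C ξ) ^ i * (X ^ η + C ξ) ^ j := by
    rw [map_mul, map_pow, map_pow, map_sub, map_add, expand_X, expand_C]
  have hleast := isLeast_multipleWeights_expand hη (h ξ hξ)
  rw [hG, ← mul_assoc, mul_comm η 2] at hleast
  refine hasHammingDistance_codeOfIdeal_span ?_ hleast
  rw [hq]
  exact mul_dvd_mul (pow_dvd_pow _ hi) (pow_dvd_pow _ hj)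

theorem X_pow_sub_C_pow_char_pow {R : Type*} [CommRing R] {p : ℕ} [Fact p.Prime] [CharP R p]
    (s : ℕ) {n : ℕ} {a : R} {A B : R[X]} (h : X ^ n - C a = A * B) :
    X ^ (n * p ^ s) - C (a ^ p ^ s) = A ^ p ^ s * B ^ p ^ s := by
  rw [← mul_pow, ← h, sub_pow_char_pow, ← pow_mul, C_pow]

end Codes

section Negacyclic

theorem exists_sq_add_one_factorization {F : Type*} [Field F] (h : IsSquare (-1 : F)) :
    ∃ ξ : F, ξ ≠ 0 ∧ (X ^ (2 * 1) - C (-1) : F[X]) = (X ^ 1 - C ξ) * (X ^ 1 + C ξ) ∧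
      Irreducible (X ^ 1 - C ξ : F[X]) ∧ Irreducible (X ^ 1 + C ξ : F[X]) := by
  obtain ⟨ξ, hξ⟩ := h
  refine ⟨ξ, ?_, ?_, ?_, ?_⟩
  · rintro rfl
    simp at hξ
  · rw [hξ, C_mul]
    ring
  · rw [pow_one]
    exact irreducible_X_sub_C ξ
  · rw [pow_one, ← sub_neg_eq_add, ← C_neg]
    exact irreducible_X_sub_C (-ξ)

theorem mod_four_eq_three_and_odd_of_pow {p m : ℕ} (h : p ^ m % 4 = 3) :
    p % 4 = 3 ∧ Odd m := by
  obtain ⟨c, hc⟩ := Nat.even_or_odd' m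
  have hsq : p ^ (2 * c) % 4 = 0 ∨ p ^ (2 * c) % 4 = 1 := by
    rw [mul_comm, pow_mul, Nat.pow_mod]
    have : p ^ c % 4 < 4 := Nat.mod_lt _ four_pos
    interval_cases p ^ c % 4 <;> simp
  rcases hc with rfl | rfl
  · omega
  · refine ⟨?_, odd_two_mul_add_one c⟩
    rw [pow_succ, Nat.mul_mod] at h
    rcases hsq with hsq | hsq <;> rw [hsq] at h <;> omega

theorem isSquare_neg_one_of_natCard_eq_pow {F : Type*} [Field F] {p m : ℕ} (hp : p ≠ 0)
    (hF : Nat.card F = p ^ m) (h : ¬ (p % 4 = 3 ∧ Odd m)) : IsSquare (-1 : F) := by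
  have : Finite F := Nat.finite_of_card_ne_zero (by rw [hF]; exact pow_ne_zero _ hp)
  have : Fintype F := Fintype.ofFinite F
  rw [FiniteField.isSquare_neg_one_iff, ← Nat.card_eq_fintype_card, hF]
  exact fun h3 => h (mod_four_eq_three_and_odd_of_pow h3)

theorem charP_of_natCard_eq_pow {F : Type*} [Field F] {p m : ℕ} [hp : Fact p.Prime]
    (hF : Nat.card F = p ^ m) : CharP F p := by
  have : Finite F := Nat.finite_of_card_ne_zero (by rw [hF]; exact pow_ne_zero _ hp.out.ne_zero)
  have : Fintype F := Fintype.ofFinite F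
  exact charP_of_card_eq_prime_pow (by rw [← Nat.card_eq_fintype_card, hF])

end Negacyclic

end RepeatedRoot

theorem theorem8p22_general (p : ℕ) [hp : Fact p.Prime] (hodd : Odd p) (s : ℕ) (hs : 0 < s)
    (F : Type*) [Field F] [CharP F p] [DecidableEq F] :
    (∀ (η : ℕ) (lam ξ ψ : F), 0 < η → ξ ≠ 0 → lam = ψ ^ p ^ s →
      (X ^ (2 * η) - C ψ : F[X]) = (X ^ η - C ξ) * (X ^ η + C ξ) →
      Irreducible (X ^ η - C ξ : F[X]) → Irreducible (X ^ η + C ξ : F[X]) →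
      (∀ D : Submodule F (Fin (2 * η * p ^ s) → F),
        RepeatedRoot.IsConstacyclic lam D ↔
          ∃ i ≤ p ^ s, ∃ j ≤ p ^ s, D = RepeatedRoot.codeIJ (2 * η * p ^ s) lam η ξ i j) ∧
      RepeatedRoot.codeIJ (2 * η * p ^ s) lam η ξ 0 0 = ⊤ ∧
      RepeatedRoot.codeIJ (2 * η * p ^ s) lam η ξ (p ^ s) (p ^ s) = ⊥ ∧
      ∀ i ≤ p ^ s, ∀ j ≤ p ^ s, (i, j) ≠ (0, 0) → (i, j) ≠ (p ^ s, p ^ s) →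
        (∃ d, RepeatedRoot.DistanceTable p s i j d ∨ RepeatedRoot.DistanceTable p s j i d) ∧
        ∀ d, RepeatedRoot.DistanceTable p s i j d ∨ RepeatedRoot.DistanceTable p s j i d →
          RepeatedRoot.HasHammingDistance
            (RepeatedRoot.codeIJ (2 * η * p ^ s) lam η ξ i j) d) ∧
    (IsSquare (-1 : F) →
      (-1 : F) = (-1) ^ p ^ s ∧
      ∃ ξ : F, ξ ≠ 0 ∧ (X ^ (2 * 1) - C (-1) : F[X]) = (X ^ 1 - C ξ) * (X ^ 1 + C ξ) ∧
        Irreducible (X ^ 1 - C ξ : F[X]) ∧ Irreducible (X ^ 1 + C ξ : F[X])) := by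
  have : NeZero (2 : F) := ⟨Ring.two_ne_zero fun h => by
    rw [ringChar.eq F p] at h
    exact absurd (h ▸ hodd) (by decide)⟩
  refine ⟨?_, fun h => ⟨hodd.pow.neg_one_pow.symm,
    RepeatedRoot.exists_sq_add_one_factorization h⟩⟩
  rintro η _ ξ ψ hη hξ rfl hψ hA hB
  have hN : 0 < 2 * η * p ^ s := by have := hp.out.pos; positivity
  have hq := RepeatedRoot.X_pow_sub_C_pow_char_pow s hψ
  refine ⟨RepeatedRoot.isConstacyclic_iff_exists_codeIJ hN hq hA hB,
    RepeatedRoot.codeIJ_zero_zero, RepeatedRoot.codeIJ_self hN hq, ?_⟩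
  intro i hi j hj h0 h1
  refine ⟨RepeatedRoot.exists_distanceTable hp.out.one_lt hi hj h0 h1, fun d hd => ?_⟩
  refine RepeatedRoot.hasHammingDistance_codeIJ hη hξ hq hi hj ?_
  rcases hd with hd | hd
  · exact hd.twoRootDistance hs h0
  · exact (hd.twoRootDistance hs fun h => h0 (by simp_all)).symm

theorem theorem8p22 (p : ℕ) (hp : p.Prime) (hodd : Odd p) (m s : ℕ) (hs : 0 < s)
    (F : Type*) [Field F] [DecidableEq F] (hF : Nat.card F = p ^ m) :
    -- the codes and their Hamming distances
    (∀ (η : ℕ) (lam ξ ψ : F), 0 < η → lam ≠ 0 → ξ ≠ 0 → ψ ≠ 0 → lam = ψ ^ p ^ s →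
      (X ^ (2 * η) - C ψ : F[X]) = (X ^ η - C ξ) * (X ^ η + C ξ) →
      Irreducible (X ^ η - C ξ : F[X]) → Irreducible (X ^ η + C ξ : F[X]) →
      (∀ D : Submodule F (Fin (2 * η * p ^ s) → F),
        RepeatedRoot.IsConstacyclic lam D ↔
          ∃ i ≤ p ^ s, ∃ j ≤ p ^ s, D = RepeatedRoot.codeIJ (2 * η * p ^ s) lam η ξ i j) ∧
      RepeatedRoot.codeIJ (2 * η * p ^ s) lam η ξ 0 0 = ⊤ ∧
      RepeatedRoot.codeIJ (2 * η * p ^ s) lam η ξ (p ^ s) (p ^ s) = ⊥ ∧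
      ∀ i ≤ p ^ s, ∀ j ≤ p ^ s, (i, j) ≠ (0, 0) → (i, j) ≠ (p ^ s, p ^ s) →
        (∃ d, RepeatedRoot.DistanceTable p s i j d ∨ RepeatedRoot.DistanceTable p s j i d) ∧
        ∀ d, RepeatedRoot.DistanceTable p s i j d ∨ RepeatedRoot.DistanceTable p s j i d →
          RepeatedRoot.HasHammingDistance
            (RepeatedRoot.codeIJ (2 * η * p ^ s) lam η ξ i j) d) ∧
    -- the hypotheses hold for the negacyclic codes of length `2 * p ^ s` (with `η = 1` and
    -- `lam = ψ = -1`), unless `p ≡ 3 (mod 4)` and `m` is odd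
    (¬ (p % 4 = 3 ∧ Odd m) →
      (-1 : F) = (-1) ^ p ^ s ∧
      ∃ ξ : F, ξ ≠ 0 ∧ (X ^ (2 * 1) - C (-1) : F[X]) = (X ^ 1 - C ξ) * (X ^ 1 + C ξ) ∧
        Irreducible (X ^ 1 - C ξ : F[X]) ∧ Irreducible (X ^ 1 + C ξ : F[X])) := by
  have : Fact p.Prime := ⟨hp⟩
  have : CharP F p := RepeatedRoot.charP_of_natCard_eq_pow hF
  obtain ⟨hcodes, hnega⟩ := theorem8p22_general p hodd s hs F
  exact ⟨fun η lam ξ ψ hη _ hξ _ => hcodes η lam ξ ψ hη hξ, fun h =>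
    hnega (RepeatedRoot.isSquare_neg_one_of_natCard_eq_pow hp.ne_zero hF h)⟩
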